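/- Let $\mathbb{H}\subset\mathbb{R}^2$ be the set of sites of the honeycomb lattice with bonds of length $1$, placed so that $(0,0)$ and $(1,0)$ are sites joined by a bond. A configuration is a map $C:\mathbb{H}\to\{-1,1\}$, where $1$ means a right rotator and $-1$ a left rotator. Given an initial configuration $C=C(0,\cdot)$, a particle moves in discrete time $t=0,1,2,\dots$ with $\mathbf{r}(0)=\mathbf{r}=(0,0)$, $\mathbf{v}(0)=(1,0)$ and $$\mathbf{r}(t+1)=\mathbf{r}(t)+\mathbf{v}(t),\qquad \mathbf{v}(t+1)=R[C(t,\mathbf{r}(t+1))]\,\mathbf{v}(t),$$ $$C(t+1,\mathbf{h})=-C(t,\mathbf{h})\ \text{ if } \mathbf{h}=\mathbf{r}(t+1),\qquad C(t+1,\mathbf{h})=C(t,\mathbf{h})\ \text{ otherwise,}$$ where $R[1]$ and $R[-1]$ are the rotations by $\pi/3$ to the right (clockwise) and to the left (counterclockwise), respectively. Write $T[s,t]$ for the trajectory $\mathbf{r}(s),\mathbf{r}(s+1),\dots,\mathbf{r}(t)$, also regarded as a set of sites. Let $\mathcal{S}$ be a set of ("shaded") hexagons of the lattice such that each site belongs to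 exactly one hexagon in $\mathcal{S}$, and let $p\in[0,1]$. In the $(H;A(p))$ model the initial configuration $C$ is random: for each $\mathcal{H}\in\mathcal{S}$ the six scatterers on $\mathcal{H}$ are all right rotators with probability $p$ and all left rotators with probability $1-p$, independently for different hexagons of $\mathcal{S}$. For $t_1<t_2$ we say that $T[t_1,t_2]$ is a self-avoiding cycle based at $\mathbf{r}(t_1)$ if $\mathbf{r}(t_1)=\mathbf{r}(t_2)$ and the positions $\mathbf{r}(t)$, $t_1\le t<t_2$, are distinct; it is a loop if $\mathbf{r}(t_1)=\mathbf{r}(t_2)$ and $\mathbf{r}(t)\ne\mathbf{r}(t_1)$ for $t_1<t<t_2$. A reflecting structure, encountered at time $t_1$, is a trajectory segment $T[t_1,t_2]$ for which there is $t_*$ with $0<t_1<t_*<t_2$ such that: $L_1=T[t_1,t_*]$ and $L_2=T[t_*,t_2]$ are loops; each of $L_1$ and $L_2$ visits each of the sites $\mathbf{r}(t_1+1)$ and $\mathbf{r}(t_2-1)$ exactly once; and $T[0,t_1-1]\cap T[t_1,t_2]=\emptyset$. Then, with probability $1$, the set of all times $t\ge 0$ with $\mathbf{r}(t)=\mathbf{r}$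 can be listed as a finite or infinite strictly increasing sequence $0=\tau_0<\tau_1<\tau_2<\cdots$, and the following hold: (a) for each $i\ge1$ for which $\tau_i$ exists, $T[\tau_{i-1},\tau_i]$ is a self-avoiding cycle based at $\mathbf{r}$; (b) if there is a last time $\tau$ at which $\mathbf{r}(\tau)=\mathbf{r}$, then $\{\mathbf{r}(t)\}_{t\ge\tau}$ is a sequence of distinct positions; (c) the particle never encounters a reflecting structure, at any time $t\ge0$. -/

import Mathlib

open MeasureTheory ProbabilityTheory

noncomputable section

namespace FlippingRotator

/-! The plane `ℝ²` is written as `ℂ`, with `x + y i` for the point `(x, y)`. -/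

/-- The translation `m a₁ + n a₂` of the honeycomb lattice of side length one, with
`a₁ = (3/2, √3/2)` and `a₂ = (3/2, -√3/2)`. -/
def translation (m n : ℤ) : ℂ :=
  ⟨3 / 2 * ((m : ℝ) + n), Real.sqrt 3 / 2 * ((m : ℝ) - n)⟩

/-- The sites of the honeycomb lattice with unit sides that has a site at the origin and a
horizontal bond from `(0, 0)` to `(1, 0)`. -/
def honeycomb : Set ℂ :=
  {z | ∃ m n : ℤ, z = translation m n ∨ z = translation m n + 1}

abbrev Site : Type := honeycomb

/-- The bonds of the lattice join the sites that are at distance one. -/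
def IsBond (z w : ℂ) : Prop :=
  z ∈ honeycomb ∧ w ∈ honeycomb ∧ dist z w = 1

/-- The hexagons of the lattice, indexed by the coordinates of their centres. -/
abbrev Hexagon : Type := ℤ × ℤ

def Hexagon.center (H : Hexagon) : ℂ := translation H.1 H.2 - 1

/-- The six sites of a hexagon: those at distance one from its centre. -/
def Hexagon.sites (H : Hexagon) : Set Site :=
  {h | dist (h : ℂ) H.center = 1}

/-- The matrix `R[z] = !![cos (π z / 3), sin (π z / 3); -sin (π z / 3), cos (π z / 3)]`
applied to `v`: the rotation to the right for `z = 1` and to the left for `z = -1`. -/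
def rotate (z : ℤˣ) (v : ℂ) : ℂ :=
  ⟨Real.cos (Real.pi / 3 * ((z : ℤ) : ℝ)) * v.re + Real.sin (Real.pi / 3 * ((z : ℤ) : ℝ)) * v.im,
   -Real.sin (Real.pi / 3 * ((z : ℤ) : ℝ)) * v.re + Real.cos (Real.pi / 3 * ((z : ℤ) : ℝ)) * v.im⟩

/-- Configurations of scatterers: `1` is a right rotator and `-1` a left rotator. -/
abbrev Configuration : Type := Site → ℤˣ

theorem rotate_one (v : ℂ) : rotate 1 v =
    ⟨v.re / 2 + Real.sqrt 3 / 2 * v.im, -(Real.sqrt 3 / 2) * v.re + v.im / 2⟩ := by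
  simp only [rotate, Units.val_one, Int.cast_one, mul_one, Real.cos_pi_div_three,
    Real.sin_pi_div_three]
  congr 1 <;> ring

theorem rotate_neg_one (v : ℂ) : rotate (-1) v =
    ⟨v.re / 2 - Real.sqrt 3 / 2 * v.im, Real.sqrt 3 / 2 * v.re + v.im / 2⟩ := by
  simp only [rotate, Units.val_neg, Units.val_one, Int.cast_neg, Int.cast_one, mul_neg, mul_one,
    Real.cos_neg, Real.sin_neg, Real.cos_pi_div_three, Real.sin_pi_div_three]
  congr 1 <;> ring

theorem norm_translation_sq (m n : ℤ) (e : ℝ) :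
    ‖translation m n + (e : ℂ)‖ ^ 2 =
      3 * ((m : ℝ) ^ 2 + m * n + n ^ 2) + 3 * e * (m + n) + e ^ 2 := by
  have h3 : Real.sqrt 3 ^ 2 = 3 := Real.sq_sqrt (by norm_num)
  rw [← Complex.normSq_eq_norm_sq, Complex.normSq_apply]
  simp only [translation, Complex.add_re, Complex.add_im, Complex.ofReal_re, Complex.ofReal_im]
  linear_combination ((m : ℝ) - n) ^ 2 / 4 * h3

theorem translation_sub (m n k l : ℤ) :
    translation m n - translation k l = translation (m - k) (n - l) := by
  apply Complex.ext <;> simp [translation] <;> ring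

theorem translation_add (m n k l : ℤ) :
    translation m n + translation k l = translation (m + k) (n + l) := by
  apply Complex.ext <;> simp [translation] <;> ring

theorem no_short (m n : ℤ) : ‖translation m n‖ ≠ 1 := by
  intro h
  have h2 := norm_translation_sq m n 0
  simp only [Complex.ofReal_zero, add_zero, h] at h2
  have : (1 : ℤ) = 3 * (m ^ 2 + m * n + n ^ 2) := by
    have : (1 : ℝ) = 3 * ((m : ℝ) ^ 2 + m * n + n ^ 2) := by linarith
    exact_mod_cast this
  omega

theorem unit_cases (m n : ℤ) (h : ‖translation m n + 1‖ = 1) :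
    (m = 0 ∧ n = 0) ∨ (m = -1 ∧ n = 0) ∨ (m = 0 ∧ n = -1) := by
  have h2 := norm_translation_sq m n 1
  simp only [Complex.ofReal_one, h] at h2
  have h3 : m ^ 2 + m * n + n ^ 2 + m + n = 0 := by
    have : (m : ℝ) ^ 2 + m * n + n ^ 2 + m + n = 0 := by linarith
    exact_mod_cast this
  have a1 : -1 ≤ m := by nlinarith [sq_nonneg (m + 2 * n + 1)]
  have a2 : m ≤ 0 := by nlinarith [sq_nonneg (m + 2 * n + 1)]
  have b1 : -1 ≤ n := by nlinarith [sq_nonneg (n + 2 * m + 1)]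
  have b2 : n ≤ 0 := by nlinarith [sq_nonneg (n + 2 * m + 1)]
  have hm : m = -1 ∨ m = 0 := by omega
  have hn : n = -1 ∨ n = 0 := by omega
  rcases hm with rfl | rfl <;> rcases hn with rfl | rfl <;> simp_all

theorem rotate_norm (z : ℤˣ) (v : ℂ) : ‖rotate z v‖ = ‖v‖ := by
  have h3 : Real.sqrt 3 ^ 2 = 3 := Real.sq_sqrt (by norm_num)
  have : ‖rotate z v‖ ^ 2 = ‖v‖ ^ 2 := by
    rw [← Complex.normSq_eq_norm_sq, ← Complex.normSq_eq_norm_sq, Complex.normSq_apply,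
      Complex.normSq_apply]
    rcases Int.units_eq_one_or z with rfl | rfl
    · rw [rotate_one]
      linear_combination (v.re ^ 2 + v.im ^ 2) / 4 * h3
    · rw [rotate_neg_one]
      linear_combination (v.re ^ 2 + v.im ^ 2) / 4 * h3
  exact (sq_eq_sq₀ (norm_nonneg _) (norm_nonneg _)).1 this

theorem rotate_neg (z : ℤˣ) (v : ℂ) : rotate z (-v) = -rotate z v := by
  apply Complex.ext <;> simp [rotate] <;> ring

/-- The three bond directions, rotated. -/
theorem rotate_direction (z : ℤˣ) (m n : ℤ) (h : ‖translation m n + 1‖ = 1) :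
    ∃ k l : ℤ, rotate z (translation m n + 1) = translation k l - 1 := by
  have h3 : Real.sqrt 3 ^ 2 = 3 := Real.sq_sqrt (by norm_num)
  rcases Int.units_eq_one_or z with rfl | rfl <;> simp only [rotate_one, rotate_neg_one] <;>
    rcases unit_cases m n h with ⟨rfl, rfl⟩ | ⟨rfl, rfl⟩ | ⟨rfl, rfl⟩
  · exact ⟨0, 1, by
      apply Complex.ext <;> simp [translation] <;> ring_nf⟩
  · exact ⟨0, 0, by
      apply Complex.ext <;> simp [translation] <;> ring_nf <;> linear_combination (-1 / 4 : ℝ) * h3⟩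
  · exact ⟨1, 0, by
      apply Complex.ext <;> simp [translation] <;> ring_nf <;> linear_combination (1 / 4 : ℝ) * h3⟩
  · exact ⟨1, 0, by
      apply Complex.ext <;> simp [translation] <;> ring_nf⟩
  · exact ⟨0, 1, by
      apply Complex.ext <;> simp [translation] <;> ring_nf <;> linear_combination (1 / 4 : ℝ) * h3⟩
  · exact ⟨0, 0, by
      apply Complex.ext <;> simp [translation] <;> ring_nf <;> linear_combination (-1 / 4 : ℝ) * h3⟩

/-- A particle that arrives at a site along a bond leaves it along a bond. -/
theorem isBond_rotate {r v : ℂ} (h : IsBond r (r + v)) (z : ℤˣ) :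
    IsBond (r + v) (r + v + rotate z v) := by
  obtain ⟨h1, h2, h3⟩ := h
  have hv : ‖v‖ = 1 := by simpa [dist_eq_norm] using h3
  refine ⟨h2, ?_, by simpa [dist_eq_norm, rotate_norm] using hv⟩
  obtain ⟨m, n, rfl | rfl⟩ := h1 <;> obtain ⟨k, l, e | e⟩ := h2
  · exact absurd hv (by
      rw [eq_sub_of_add_eq' e, translation_sub]; exact no_short _ _)
  · have ev : v = translation (k - m) (l - n) + 1 := by
      rw [← translation_sub]; linear_combination e
    obtain ⟨a, b, hab⟩ := rotate_direction z _ _ (ev ▸ hv)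
    refine ⟨k + a, l + b, Or.inl ?_⟩
    rw [e, ev, hab, ← translation_add]; ring
  · have ev : v = -(translation (m - k) (n - l) + 1) := by
      rw [← translation_sub]; linear_combination e
    have hv' : ‖translation (m - k) (n - l) + 1‖ = 1 := by rw [ev, norm_neg] at hv; exact hv
    obtain ⟨a, b, hab⟩ := rotate_direction z _ _ hv'
    refine ⟨k - a, l - b, Or.inr ?_⟩
    rw [e, ev, rotate_neg, hab, ← translation_sub]; ring
  · exact absurd hv (by
      rw [show v = translation k l - translation m n by linear_combination e, translation_sub]
      exact no_short _ _)

theorem isBond_zero_one : IsBond 0 (0 + 1) :=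
  ⟨⟨0, 0, Or.inl (by apply Complex.ext <;> simp [translation])⟩,
    ⟨0, 0, Or.inr (by apply Complex.ext <;> simp [translation])⟩, by simp⟩

/-- The state of the system at a time: the position of the particle, its velocity immediately
after that time step, which points along a bond, and the configuration of the scatterers. -/
structure State where
  pos : Site
  vel : ℂ
  cfg : Configuration
  isBond : IsBond (pos : ℂ) ((pos : ℂ) + vel)

def State.nextPos (s : State) : Site := ⟨(s.pos : ℂ) + s.vel, s.isBond.2.1⟩

open Classical in
/-- One time step: the particle moves to the next site, is rotated by the scatterer there, and
that scatterer flips. -/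
def State.step (s : State) : State where
  pos := s.nextPos
  vel := rotate (s.cfg s.nextPos) s.vel
  cfg := Function.update s.cfg s.nextPos (-s.cfg s.nextPos)
  isBond := isBond_rotate s.isBond (s.cfg s.nextPos)

/-- The initial state: the particle is at `(0, 0)` with velocity `(1, 0)`. -/
def initialState (C : Configuration) : State where
  pos := ⟨0, isBond_zero_one.1⟩
  vel := 1
  cfg := C
  isBond := isBond_zero_one

/-- The position `r(t)` of the particle at time `t`, for the initial configuration `C`. -/
def position (C : Configuration) (t : ℕ) : ℂ :=
  (State.step^[t] (initialState C)).pos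

/-- `T[t₁, t₂]` is a self-avoiding cycle based at `r(t₁)`. -/
def IsSelfAvoidingCycle (r : ℕ → ℂ) (t₁ t₂ : ℕ) : Prop :=
  t₁ < t₂ ∧ Set.InjOn r (Set.Ico t₁ t₂) ∧ r t₁ = r t₂

/-- `T[t₁, t₂]` is a loop based at `r(t₁)`. -/
def IsLoop (r : ℕ → ℂ) (t₁ t₂ : ℕ) : Prop :=
  r t₁ = r t₂ ∧ ∀ t, t₁ < t → t < t₂ → r t ≠ r t₁

/-- `T[t₁, t₂]` visits the point `z` exactly once. -/
def VisitsOnce (r : ℕ → ℂ) (t₁ t₂ : ℕ) (z : ℂ) : Prop :=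
  ∃! t, t ∈ Set.Icc t₁ t₂ ∧ r t = z

/-- `T[t₁, t₂]` is a reflecting structure, which the particle encounters at time `t₁`. -/
def IsReflectingStructure (r : ℕ → ℂ) (t₁ t₂ : ℕ) : Prop :=
  ∃ s, 0 < t₁ ∧ t₁ < s ∧ s < t₂ ∧
    IsLoop r t₁ s ∧ IsLoop r s t₂ ∧
    VisitsOnce r t₁ s (r (t₁ + 1)) ∧ VisitsOnce r t₁ s (r (t₂ - 1)) ∧
    VisitsOnce r s t₂ (r (t₁ + 1)) ∧ VisitsOnce r s t₂ (r (t₂ - 1)) ∧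
    r '' Set.Icc 0 (t₁ - 1) ∩ r '' Set.Icc t₁ t₂ = ∅

/-- A set of shaded hexagons: each site belongs to exactly one of them. -/
def IsShading (S : Set Hexagon) : Prop :=
  ∀ h : Site, ∃! H : Hexagon, H ∈ S ∧ h ∈ H.sites

/-- The random initial configuration of the `(H; A(p))` model: the scatterers of each shaded
hexagon are all right rotators with probability `p` and all left rotators with probability
`1 - p`, independently for different shaded hexagons. -/
structure IsShadedRandomConfiguration {Ω : Type*} [MeasurableSpace Ω] (μ : Measure Ω)
    (S : Set Hexagon) (p : ℝ) (C : Ω → Configuration) : Prop where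
  measurable : ∀ h : Site, Measurable fun ω => C ω h
  right : ∀ H ∈ S, μ {ω | ∀ h ∈ Hexagon.sites H, C ω h = 1} = ENNReal.ofReal p
  left : ∀ H ∈ S, μ {ω | ∀ h ∈ Hexagon.sites H, C ω h = -1} = ENNReal.ofReal (1 - p)
  indep : iIndepFun (fun (H : S) (ω : Ω) (h : Hexagon.sites H.1) => C ω h.1) μ

end FlippingRotator

end

open FlippingRotator

namespace FlippingRotator

/-! The honeycomb is a bipartite cubic graph. A configuration is read as prescribing, up to a sign
given by the class of the site, the cyclic order in which three edge colours appear around each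
site. If a proper 3-edge-colouring with these orders exists (`Coherent`), each turn shifts the
colour by the sign of the class, so the particle's colours alternate between two values: it follows
a two-coloured (Kempe) chain. Such a chain can meet itself only by closing up at its start. Once it
has closed, flipping the scatterers along it amounts to swapping its two colours, so coherence is
restored (`Coherent.return`). By induction over returns, the path is self-avoiding from each visit
to the origin until the next (`Coherent.injOn_Icc`), and all three claims follow.

A configuration constant on shaded hexagons is coherent (`IsShading.coherent`): bonds on no shaded
hexagon get one colour, and around each shaded hexagon the other two alternate. The random
configuration is almost surely constant on each of the countably many shaded hexagons
(`IsShadedRandomConfiguration.ae_constant`). -/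

/-- The residue modulo three of a sign. -/
def sgn (u : ℤˣ) : ZMod 3 := ((u : ℤ) : ZMod 3)

/-! ### Rotator walks and edge colourings on bipartite cubic graphs -/

/-- A bipartite cubic graph whose edges are indexed by `ZMod 3`, with `side` the two classes. -/
structure CubicGraph (V : Type*) where
  nbr : V → ZMod 3 → V
  side : V → ℤˣ
  nbr_nbr : ∀ v j, nbr (nbr v j) j = v
  side_nbr : ∀ v j, side (nbr v j) = -side v

/-- A particle at `pos`, about to leave along the edge `dir`, among the scatterers `cfg`. -/
structure Walker (V : Type*) where
  pos : V
  dir : ZMod 3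
  cfg : V → ℤˣ

namespace CubicGraph

variable {V : Type*} (G : CubicGraph V)

open Classical in
/-- One time step of the flipping rotator dynamics. -/
noncomputable def step (s : Walker V) : Walker V where
  pos := G.nbr s.pos s.dir
  dir := s.dir + sgn (s.cfg (G.nbr s.pos s.dir))
  cfg := Function.update s.cfg (G.nbr s.pos s.dir) (-s.cfg (G.nbr s.pos s.dir))

/-- The colour of the edge `j` at the site `h`. -/
def color (σ : V → ℤˣ) (k : V → ZMod 3) (h : V) (j : ZMod 3) : ZMod 3 :=
  k h + sgn (G.side h) * sgn (σ h) * j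

/-- A configuration is coherent if it is the orientation of a proper `3`-edge-colouring. -/
def Coherent (σ : V → ℤˣ) : Prop :=
  ∃ k : V → ZMod 3, ∀ h j, G.color σ k (G.nbr h j) j = G.color σ k h j

/-- The sign of the scatterer squares to one, so a turn acts on colours only through the class of
the site. -/
theorem color_add (σ : V → ℤˣ) (k : V → ZMod 3) (h : V) (j : ZMod 3) :
    G.color σ k h (j + sgn (σ h)) = G.color σ k h j + sgn (G.side h) := by
  simp only [color]
  have : sgn (σ h) * sgn (σ h) = 1 := by
    rcases Int.units_eq_one_or (σ h) with e | e <;> rw [e] <;> decide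
  linear_combination sgn (G.side h) * this

theorem color_injective (σ : V → ℤˣ) (k : V → ZMod 3) (h : V) :
    Function.Injective (G.color σ k h) := by
  intro i j e
  simp only [color, add_right_inj] at e
  rcases Int.units_eq_one_or (σ h) with e1 | e1 <;>
    rcases Int.units_eq_one_or (G.side h) with e2 | e2 <;> rw [e1, e2] at e <;>
    revert i j <;> decide

/-- The colour along which a walk that starts at the side `ε` along the colour `c` leaves a site
of the side `u`. -/
def exitColor (ε : ℤˣ) (c : ZMod 3) (u : ℤˣ) : ZMod 3 := if u = ε then c else c - sgn ε

theorem exitColor_step (ε u : ℤˣ) (c : ZMod 3) :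
    exitColor ε c u + sgn (-u) = exitColor ε c (-u) := by
  revert c
  rcases Int.units_eq_one_or u with rfl | rfl <;>
    rcases Int.units_eq_one_or ε with rfl | rfl <;> decide

/-- The reflection swaps the two colours of the chain, `c` and `c - sgn ε`, and fixes the third. -/
theorem reflect_eq_self (ε u : ℤˣ) (c x : ZMod 3) (h1 : x ≠ exitColor ε c u)
    (h2 : x ≠ exitColor ε c (-u)) : 2 * c - sgn ε - x = x := by
  revert c x
  rcases Int.units_eq_one_or u with rfl | rfl <;>
    rcases Int.units_eq_one_or ε with rfl | rfl <;> decide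

/-- The position at time `t`. -/
noncomputable def path (s : Walker V) (t : ℕ) : V := (G.step^[t] s).pos

/-- The exit edge at time `t`. -/
noncomputable def exit (s : Walker V) (t : ℕ) : ZMod 3 := (G.step^[t] s).dir

theorem path_succ (s : Walker V) (t : ℕ) :
    G.path s (t + 1) = G.nbr (G.path s t) (G.exit s t) := by
  simp [path, exit, Function.iterate_succ_apply', step]

theorem nbr_path_succ (s : Walker V) (t : ℕ) :
    G.nbr (G.path s (t + 1)) (G.exit s t) = G.path s t := by
  rw [path_succ, nbr_nbr]

theorem exit_succ (s : Walker V) (t : ℕ) :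
    G.exit s (t + 1) = G.exit s t + sgn ((G.step^[t] s).cfg (G.path s (t + 1))) := by
  rw [path_succ]; simp [path, exit, Function.iterate_succ_apply', step]

open Classical in
theorem cfg_succ (s : Walker V) (t : ℕ) :
    (G.step^[t + 1] s).cfg = Function.update (G.step^[t] s).cfg (G.path s (t + 1))
      (-(G.step^[t] s).cfg (G.path s (t + 1))) := by
  rw [path_succ]; simp [path, exit, Function.iterate_succ_apply', step]

theorem path_add (s : Walker V) (t u : ℕ) :
    G.path s (t + u) = G.path (G.step^[t] s) u := by
  rw [path, path, add_comm, Function.iterate_add_apply]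

variable {G}

/-! ### Self-avoidance and recolouring during one round -/

/-- What holds at time `t` of a walk in an environment with the colouring `k`, as long as the
sites met so far are new. -/
structure IsRound (s : Walker V) (k : V → ZMod 3) (t : ℕ) : Prop where
  visited : ∀ u, 0 < u → u ≤ t → (G.step^[t] s).cfg (G.path s u) = -s.cfg (G.path s u)
  fresh : ∀ h, (∀ u, 0 < u → u ≤ t → G.path s u ≠ h) → (G.step^[t] s).cfg h = s.cfg h
  exit_color : ∀ u ≤ t, G.color s.cfg k (G.path s u) (G.exit s u) =
    exitColor (G.side s.pos) (G.color s.cfg k s.pos s.dir) (G.side (G.path s u))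
  -- Time `0` is left out so that the round may end at its starting site.
  inj : Set.InjOn (G.path s) (Set.Ioc 0 t)

theorem isRound_zero (s : Walker V) (k : V → ZMod 3) : G.IsRound s k 0 := by
  refine ⟨fun u h1 h2 => by omega, fun h _ => rfl, fun u hu => ?_, by simp⟩
  obtain rfl : u = 0 := by omega
  simp [path, exit, exitColor]

theorem entry_color {s : Walker V} {k : V → ZMod 3}
    (hk : ∀ h j, G.color s.cfg k (G.nbr h j) j = G.color s.cfg k h j) {t : ℕ}
    (h : G.IsRound s k t) {u : ℕ} (hu : u ≤ t) :
    G.color s.cfg k (G.path s (u + 1)) (G.exit s u) =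
      exitColor (G.side s.pos) (G.color s.cfg k s.pos s.dir) (-G.side (G.path s (u + 1))) := by
  rw [path_succ, hk, h.exit_color u hu, side_nbr, neg_neg]

theorem IsRound.succ {s : Walker V} {k : V → ZMod 3}
    (hk : ∀ h j, G.color s.cfg k (G.nbr h j) j = G.color s.cfg k h j) {t : ℕ}
    (h : G.IsRound s k t) (ht : ∀ u, 0 < u → u ≤ t → G.path s u ≠ s.pos) :
    G.IsRound s k (t + 1) := by
  classical
  -- The entry colour depends only on the class of the site, so two arrivals at one site use the
  -- same edge and come from the same predecessor. That is an earlier coincidence, or a return to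
  -- the start.
  have new : ∀ u, 0 < u → u ≤ t → G.path s u ≠ G.path s (t + 1) := by
    intro u hu hut e
    obtain ⟨u, rfl⟩ : ∃ w, u = w + 1 := ⟨u - 1, by omega⟩
    have e1 := entry_color hk h (show u ≤ t by omega)
    have e2 := entry_color hk h (le_refl t)
    rw [← e, ← e1] at e2
    have e3 := G.color_injective _ _ _ e2
    have e4 : G.path s t = G.path s u := by
      rw [← nbr_path_succ, ← nbr_path_succ G s u, e, e3]
    rcases Nat.eq_zero_or_pos u with rfl | hu0
    · exact ht t (by omega) le_rfl e4
    · have := h.inj ⟨by omega, le_rfl⟩ ⟨hu0, by omega⟩ e4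
      omega
  have hc := h.fresh _ new
  refine ⟨fun u h1 h2 => ?_, fun x hx => ?_, fun u hu => ?_, ?_⟩
  · rw [cfg_succ]
    rcases Nat.lt_or_ge t u with h3 | h3
    · obtain rfl : u = t + 1 := by omega
      rw [Function.update_self, hc]
    · rw [Function.update_of_ne (new u h1 h3), h.visited u h1 h3]
  · rw [cfg_succ, Function.update_of_ne (hx (t + 1) (by omega) le_rfl).symm]
    exact h.fresh x fun u h1 h2 => hx u h1 (by omega)
  · rcases Nat.lt_or_ge t u with h3 | h3
    · obtain rfl : u = t + 1 := by omega
      rw [exit_succ, hc, color_add, entry_color hk h le_rfl]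
      have := exitColor_step (G.side s.pos) (-G.side (G.path s (t + 1)))
        (G.color s.cfg k s.pos s.dir)
      rwa [neg_neg] at this
    · exact h.exit_color u h3
  · intro a ha b hb e
    obtain ⟨ha, ha'⟩ := ha
    obtain ⟨hb, hb'⟩ := hb
    rcases Nat.lt_or_ge t a with h3 | h3 <;> rcases Nat.lt_or_ge t b with h4 | h4
    · omega
    · obtain rfl : a = t + 1 := by omega
      exact absurd e.symm (new b hb h4)
    · obtain rfl : b = t + 1 := by omega
      exact absurd e (new a ha h3)
    · exact h.inj ⟨ha, h3⟩ ⟨hb, h4⟩ e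

theorem isRound_of_no_return {s : Walker V} {k : V → ZMod 3}
    (hk : ∀ h j, G.color s.cfg k (G.nbr h j) j = G.color s.cfg k h j) {t : ℕ}
    (ht : ∀ u, 0 < u → u < t → G.path s u ≠ s.pos) : G.IsRound s k t := by
  induction t with
  | zero => exact isRound_zero s k
  | succ t ih =>
    exact (ih fun u h1 h2 => ht u h1 (by omega)).succ hk fun u h1 h2 => ht u h1 (by omega)

/-- A walk in a coherent environment is self-avoiding until it returns. -/
theorem Coherent.injOn {s : Walker V} (hs : G.Coherent s.cfg) {t : ℕ}
    (ht : ∀ u, 0 < u → u ≤ t → G.path s u ≠ s.pos) : Set.InjOn (G.path s) (Set.Icc 0 t) := by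
  obtain ⟨k, hk⟩ := hs
  have h := isRound_of_no_return hk (t := t) fun u h1 h2 => ht u h1 h2.le
  intro a ha b hb e
  rcases Nat.eq_zero_or_pos a with rfl | ha0 <;> rcases Nat.eq_zero_or_pos b with rfl | hb0
  · rfl
  · exact absurd e.symm (ht b hb0 hb.2)
  · exact absurd e (ht a ha0 ha.2)
  · exact h.inj ⟨ha0, ha.2⟩ ⟨hb0, hb.2⟩ e

/-- At its first return, a walk in a coherent environment has made it coherent again. -/
theorem Coherent.return {s : Walker V} (hs : G.Coherent s.cfg) {t : ℕ} (ht0 : 0 < t)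
    (ht : ∀ u, 0 < u → u < t → G.path s u ≠ s.pos) (hret : G.path s t = s.pos) :
    G.Coherent (G.step^[t] s).cfg := by
  classical
  obtain ⟨k, hk⟩ := hs
  have h := isRound_of_no_return hk ht
  set c := G.color s.cfg k s.pos s.dir with hc
  set ε := G.side s.pos with hε
  let P : V → Prop := fun x => ∃ u, 0 < u ∧ u ≤ t ∧ G.path s u = x
  -- Reflecting all colours at the visited sites reverses their cyclic order there, which matches
  -- the flipped scatterers.
  let k' : V → ZMod 3 := fun x => if P x then 2 * c - sgn ε - k x else k x
  have hP : ∀ x, P x → ∀ j, G.color (G.step^[t] s).cfg k' x j =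
      2 * c - sgn ε - G.color s.cfg k x j := by
    rintro x hx j
    have h1 : k' x = 2 * c - sgn ε - k x := if_pos hx
    obtain ⟨u, hu, hut, rfl⟩ := hx
    have h2 : sgn (-s.cfg (G.path s u)) = -sgn (s.cfg (G.path s u)) := by simp [sgn]
    simp only [color, h1, h.visited u hu hut, h2]
    ring
  have hN : ∀ x, ¬ P x → ∀ j, G.color (G.step^[t] s).cfg k' x j = G.color s.cfg k x j := by
    intro x hx j
    have h1 : k' x = k x := if_neg hx
    rw [color, color, h1, h.fresh x fun u hu hut e => hx ⟨u, hu, hut, e⟩]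
  have hP0 : P (G.path s 0) := ⟨t, ht0, le_rfl, hret⟩
  -- The exit and entry edges of a visited site lead to visited sites. An edge to an unvisited site
  -- therefore has the third colour, which the reflection fixes.
  have hcross : ∀ x j, P x → ¬ P (G.nbr x j) →
      2 * c - sgn ε - G.color s.cfg k x j = G.color s.cfg k x j := by
    rintro x j ⟨u, hu, hut, rfl⟩ hy
    refine reflect_eq_self ε (G.side (G.path s u)) c _ (fun e => hy ?_) (fun e => hy ?_)
    · have ej := G.color_injective _ _ _ (e.trans (h.exit_color u hut).symm)
      rw [ej, ← path_succ]
      rcases Nat.lt_or_ge u t with h3 | h3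
      · exact ⟨u + 1, by omega, h3, rfl⟩
      -- The site after time `t` is outside the round, but on return the walk has its initial exit
      -- edge again, which leads to the site of time `1`.
      · obtain rfl : u = t := by omega
        have e0 := h.exit_color 0 (by omega)
        have e1 := h.exit_color u le_rfl
        rw [hret] at e1
        have e2 : G.exit s u = G.exit s 0 := by
          apply G.color_injective s.cfg k s.pos
          rw [e1]; exact e0.symm
        refine ⟨1, one_pos, ht0, ?_⟩
        rw [path_succ, path_succ, hret, e2]; rfl
    · obtain ⟨u, rfl⟩ : ∃ w, u = w + 1 := ⟨u - 1, by omega⟩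
      have ej := G.color_injective _ _ _
        (e.trans (entry_color hk h (show u ≤ t by omega)).symm)
      rw [ej, nbr_path_succ]
      rcases Nat.eq_zero_or_pos u with rfl | hu0
      · exact hP0
      · exact ⟨u, hu0, by omega, rfl⟩
  refine ⟨k', fun x j => ?_⟩
  by_cases hx : P x <;> by_cases hy : P (G.nbr x j)
  · rw [hP x hx, hP _ hy, hk]
  · rw [hP x hx, hN _ hy, hk, hcross x j hx hy]
  · have := hcross (G.nbr x j) j hy (by rwa [nbr_nbr])
    rw [hN x hx, hP _ hy, this, hk]
  · rw [hN x hx, hN _ hy, hk]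

/-- Cut at the first return: the rest of the walk starts at the same site in an environment that is
coherent again. -/
theorem Coherent.at_return {s : Walker V} (hs : G.Coherent s.cfg) (t : ℕ)
    (ht : G.path s t = s.pos) : G.Coherent (G.step^[t] s).cfg := by
  induction t using Nat.strong_induction_on generalizing s with
  | _ t ih =>
    rcases Nat.eq_zero_or_pos t with rfl | ht0
    · exact hs
    classical
    have hex : ∃ u, 0 < u ∧ G.path s u = s.pos := ⟨t, ht0, ht⟩
    obtain ⟨h1, h2⟩ := Nat.find_spec hex
    have h3 : Nat.find hex ≤ t := Nat.find_min' hex ⟨ht0, ht⟩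
    set u := Nat.find hex with hu
    have h4 := hs.return h1 (fun w hw hwu e => Nat.find_min hex hwu ⟨hw, e⟩) h2
    have e : t = u + (t - u) := by omega
    have h5 := ih (t - u) (by omega) h4 (by
      rw [← path_add, ← e, ht]; exact h2.symm)
    rwa [← Function.iterate_add_apply, Nat.sub_add_cancel h3] at h5

/-- A walk that starts in a coherent environment is self-avoiding between returns. -/
theorem Coherent.injOn_Icc {s : Walker V} (hs : G.Coherent s.cfg) {τ t : ℕ}
    (hτ : G.path s τ = s.pos) (ht : ∀ u, τ < u → u ≤ t → G.path s u ≠ s.pos) :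
    Set.InjOn (G.path s) (Set.Icc τ t) := by
  have h := (hs.at_return τ hτ).injOn (t := t - τ) (by
    intro u h1 h2
    rw [← path_add]
    exact fun e => ht (τ + u) (by omega) (by omega) (e.trans hτ))
  rintro a ⟨ha, ha'⟩ b ⟨hb, hb'⟩ e
  have := @h (a - τ) ⟨by omega, by omega⟩ (b - τ) ⟨by omega, by omega⟩ (by
    rw [← path_add, ← path_add, Nat.add_sub_cancel' ha, Nat.add_sub_cancel' hb, e])
  omega

end CubicGraph

/-! ### The honeycomb lattice as a bipartite cubic graph -/

/-- The site `(m, n, 1)` is `translation m n` and `(m, n, -1)` is `translation m n + 1`. -/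
abbrev Vertex : Type := ℤ × ℤ × ℤˣ

/-- The translations between the left end and the right end of the three bonds of a site. -/
def offset : ZMod 3 → ℤ × ℤ
  | 0 => (0, 0)
  | 1 => (0, -1)
  | 2 => (-1, 0)

/-- The three directions of the bonds. -/
noncomputable def direction (j : ZMod 3) : ℂ := translation (offset j).1 (offset j).2 + 1

/-- A right turn by `π/3` is a left turn by `2π/3` followed by a reversal. The reversal is the
change of class, and the rest shifts the bond index by one. -/
theorem rotate_direction_index (z ε : ℤˣ) (j : ZMod 3) :
    rotate z (((ε : ℤ) : ℂ) * direction j) = (((-ε : ℤˣ) : ℤ) : ℂ) * direction (j + sgn z) := by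
  have h3 : Real.sqrt 3 ^ 2 = 3 := Real.sq_sqrt (by norm_num)
  have d0 : direction 0 = ⟨1, 0⟩ := by
    apply Complex.ext <;> simp [direction, offset, translation]
  have d1 : direction 1 = ⟨-1 / 2, Real.sqrt 3 / 2⟩ := by
    apply Complex.ext <;> simp [direction, offset, translation]; norm_num
  have d2 : direction 2 = ⟨-1 / 2, -(Real.sqrt 3 / 2)⟩ := by
    apply Complex.ext <;> simp [direction, offset, translation]; norm_num
  have hj : j = 0 ∨ j = 1 ∨ j = 2 := by revert j; decide
  have a1 : (0 : ZMod 3) + sgn 1 = 1 := by decide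
  have a2 : (1 : ZMod 3) + sgn 1 = 2 := by decide
  have a3 : (2 : ZMod 3) + sgn 1 = 0 := by decide
  have b1 : (0 : ZMod 3) + sgn (-1) = 2 := by decide
  have b2 : (1 : ZMod 3) + sgn (-1) = 0 := by decide
  have b3 : (2 : ZMod 3) + sgn (-1) = 1 := by decide
  have key : rotate z (direction j) = -direction (j + sgn z) := by
    rcases Int.units_eq_one_or z with rfl | rfl <;> rcases hj with rfl | rfl | rfl <;>
      simp only [a1, a2, a3, b1, b2, b3, d0, d1, d2, rotate_one, rotate_neg_one] <;>
      apply Complex.ext <;> simp <;> ring_nf <;> norm_num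
  rcases Int.units_eq_one_or ε with rfl | rfl
  · simp [key]
  · simp [key, rotate_neg]

/-- For `i ≠ j` the third index is `2 * j - i`, so all three offsets are summed. -/
theorem offset_sum (i j : ZMod 3) (h : i ≠ j) :
    offset i + offset j + offset (2 * j - i) = (-1, -1) := by
  revert i j; decide

/-- The honeycomb lattice. -/
def honeycombGraph : CubicGraph Vertex where
  nbr v j := (v.1 + (v.2.2 : ℤ) * (offset j).1, v.2.1 + (v.2.2 : ℤ) * (offset j).2, -v.2.2)
  side v := v.2.2
  nbr_nbr v j := by simp
  side_nbr v j := rfl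

/-- The point of the plane at a vertex. -/
noncomputable def point (v : Vertex) : ℂ :=
  translation v.1 v.2.1 + (1 - (((v.2.2 : ℤˣ) : ℤ) : ℂ)) / 2

theorem point_nbr (v : Vertex) (j : ZMod 3) :
    point (honeycombGraph.nbr v j) = point v + ((v.2.2 : ℤ) : ℂ) * direction j := by
  obtain ⟨m, n, ε⟩ := v
  rcases Int.units_eq_one_or ε with rfl | rfl
  · apply Complex.ext <;> simp [point, honeycombGraph, direction, translation] <;> ring
  · apply Complex.ext <;> simp [point, honeycombGraph, direction, translation] <;> ring

theorem translation_injective {m n k l : ℤ} (h : translation m n = translation k l) :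
    m = k ∧ n = l := by
  have h1 := congrArg Complex.re h
  have h2 := congrArg Complex.im h
  simp only [translation] at h1 h2
  have h3 : (0 : ℝ) < Real.sqrt 3 / 2 := by positivity
  have h4 := mul_left_cancel₀ h3.ne' h2
  have h5 : (m : ℝ) = k := by linarith
  have h6 : (n : ℝ) = l := by linarith
  exact ⟨by exact_mod_cast h5, by exact_mod_cast h6⟩

theorem translation_ne_translation_add_one (m n k l : ℤ) :
    translation m n ≠ translation k l + 1 := by
  intro h
  refine no_short (m - k) (n - l) ?_
  rw [← translation_sub, h]; simp

theorem point_injective : Function.Injective point := by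
  rintro ⟨m, n, ε⟩ ⟨k, l, η⟩ h
  rcases Int.units_eq_one_or ε with rfl | rfl <;> rcases Int.units_eq_one_or η with rfl | rfl <;>
    norm_num [point] at h
  · obtain ⟨rfl, rfl⟩ := translation_injective h; rfl
  · exact absurd h (translation_ne_translation_add_one _ _ _ _)
  · exact absurd h.symm (translation_ne_translation_add_one _ _ _ _)
  · obtain ⟨rfl, rfl⟩ := translation_injective h; rfl

theorem point_mem (v : Vertex) : point v ∈ honeycomb := by
  obtain ⟨m, n, ε⟩ := v
  refine ⟨m, n, ?_⟩
  rcases Int.units_eq_one_or ε with rfl | rfl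
  · left; simp [point]
  · right; norm_num [point]

/-- The site at a vertex. -/
noncomputable def site (v : Vertex) : Site := ⟨point v, point_mem v⟩

theorem site_injective : Function.Injective site := fun _ _ h =>
  point_injective (congrArg Subtype.val h)

theorem site_surjective : Function.Surjective site := by
  rintro ⟨z, m, n, h | h⟩
  · exact ⟨(m, n, 1), Subtype.ext (by simp [site, point, h])⟩
  · exact ⟨(m, n, -1), Subtype.ext (by norm_num [site, point, h])⟩

instance : Countable Site := site_surjective.countable

/-- The walker on the honeycomb lattice follows the particle in the plane. -/
structure Follows (s : State) (w : Walker Vertex) : Prop where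
  pos : s.pos = site w.pos
  vel : s.vel = ((w.pos.2.2 : ℤ) : ℂ) * direction w.dir
  cfg : ∀ v, s.cfg (site v) = w.cfg v

theorem Follows.step {s : State} {w : Walker Vertex} (h : Follows s w) :
    Follows s.step (honeycombGraph.step w) := by
  have hp : s.nextPos = site (honeycombGraph.nbr w.pos w.dir) := by
    apply Subtype.ext
    simp only [State.nextPos, site, point_nbr, h.pos, h.vel]
  refine ⟨hp, ?_, fun v => ?_⟩
  · simp only [State.step, CubicGraph.step]
    rw [hp, h.cfg, h.vel, rotate_direction_index]
    rfl
  · simp only [State.step, CubicGraph.step]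
    rw [hp, h.cfg]
    simp only [Function.update_apply, site_injective.eq_iff, h.cfg]
    split_ifs <;> rfl

/-- The walker that starts with the particle. -/
noncomputable def initialWalker (C : Configuration) : Walker Vertex where
  pos := (0, 0, 1)
  dir := 0
  cfg := fun v => C (site v)

theorem point_origin : point (0, 0, 1) = 0 := by
  apply Complex.ext <;> simp [point, translation]

theorem position_eq (C : Configuration) (t : ℕ) :
    position C t = point (honeycombGraph.path (initialWalker C) t) := by
  have : Follows (State.step^[t] (initialState C))
      (honeycombGraph.step^[t] (initialWalker C)) := by
    induction t with
    | zero =>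
      refine ⟨Subtype.ext ?_, ?_, fun v => rfl⟩
      · exact point_origin.symm
      · apply Complex.ext <;>
          simp [initialState, initialWalker, direction, offset, translation]
    | succ t ih =>
      rw [Function.iterate_succ_apply', Function.iterate_succ_apply']
      exact ih.step
  rw [position, this.pos]; rfl

/-! ### Shaded hexagons and coherence -/

/-- The hexagon at a vertex that does not contain its bond with index `i`. -/
def oppositeHexagon (v : Vertex) (i : ZMod 3) : Hexagon :=
  if v.2.2 = 1 then (v.1 - (offset i).1, v.2.1 - (offset i).2)
  else (v.1 + (offset i).1 + 1, v.2.1 + (offset i).2 + 1)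

theorem oppositeHexagon_injective (v : Vertex) : Function.Injective (oppositeHexagon v) := by
  have : Function.Injective offset := by decide
  intro i j h
  apply this
  unfold oppositeHexagon at h
  split_ifs at h <;> simp only [Prod.mk.injEq] at h <;> apply Prod.ext <;> omega

/-- As `i ≠ j`, this hexagon contains the bond `j` and so both its ends; seen from the other end,
the bond it misses has the third index. -/
theorem oppositeHexagon_nbr (v : Vertex) (i j : ZMod 3) (h : i ≠ j) :
    oppositeHexagon (honeycombGraph.nbr v j) (2 * j - i) = oppositeHexagon v i := by
  have h1 := offset_sum i j h
  simp only [Prod.ext_iff, Prod.fst_add, Prod.snd_add] at h1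
  obtain ⟨m, n, ε⟩ := v
  rcases Int.units_eq_one_or ε with rfl | rfl <;>
    simp [oppositeHexagon, honeycombGraph, Prod.ext_iff] <;> omega

theorem site_mem_sites_iff (v : Vertex) (H : Hexagon) :
    site v ∈ H.sites ↔ ∃ i, H = oppositeHexagon v i := by
  obtain ⟨m, n, ε⟩ := v
  obtain ⟨a, b⟩ := H
  have hu : ∀ k l : ℤ, ‖translation k l + 1‖ = 1 ↔ ∃ i, (k, l) = offset i := by
    intro k l
    constructor
    · intro h
      rcases unit_cases k l h with ⟨rfl, rfl⟩ | ⟨rfl, rfl⟩ | ⟨rfl, rfl⟩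
      exacts [⟨0, rfl⟩, ⟨2, rfl⟩, ⟨1, rfl⟩]
    · rintro ⟨i, hi⟩
      have h2 := norm_translation_sq k l 1
      have h3 : k ^ 2 + k * l + l ^ 2 + k + l = 0 := by
        have : ∀ i : ZMod 3, i = 0 ∨ i = 1 ∨ i = 2 := by decide
        rcases this i with rfl | rfl | rfl <;> simp only [offset, Prod.mk.injEq] at hi <;>
          obtain ⟨rfl, rfl⟩ := hi <;> norm_num
      have h4 : (k : ℝ) ^ 2 + k * l + l ^ 2 + k + l = 0 := by exact_mod_cast h3
      have h5 : ‖translation k l + 1‖ ^ 2 = 1 := by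
        rw [Complex.ofReal_one] at h2
        rw [h2]; linarith
      exact (pow_eq_one_iff_of_nonneg (norm_nonneg _) two_ne_zero).1 h5
  simp only [Hexagon.sites, Set.mem_ofPred_eq, dist_eq_norm, site, Hexagon.center]
  rcases Int.units_eq_one_or ε with rfl | rfl
  · have : point (m, n, 1) - (translation a b - 1) = translation (m - a) (n - b) + 1 := by
      rw [← translation_sub]; simp [point]; ring
    rw [this, hu]
    refine exists_congr fun i => ?_
    simp only [oppositeHexagon, if_true, Prod.ext_iff]
    omega
  · have : point (m, n, -1) - (translation a b - 1) =
        -(translation (a - m - 1) (b - n - 1) + 1) := by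
      apply Complex.ext <;> simp [point, translation] <;> ring
    rw [this, norm_neg, hu]
    refine exists_congr fun i => ?_
    simp [oppositeHexagon, Prod.ext_iff]
    omega

/-- A configuration that is constant on the hexagons of a shading is coherent. -/
theorem IsShading.coherent {S : Set Hexagon} (hS : IsShading S) {C : Configuration}
    (hC : ∀ H ∈ S, ∀ h ∈ H.sites, ∀ h' ∈ H.sites, C h = C h') :
    honeycombGraph.Coherent fun v => C (site v) := by
  have hex : ∀ v, ∃ i, oppositeHexagon v i ∈ S := by
    intro v
    obtain ⟨H, ⟨h1, h2⟩, -⟩ := hS (site v)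
    obtain ⟨i, rfl⟩ := (site_mem_sites_iff v H).1 h2
    exact ⟨i, h1⟩
  have huniq : ∀ v i j, oppositeHexagon v i ∈ S → oppositeHexagon v j ∈ S → i = j := by
    intro v i j hi hj
    exact oppositeHexagon_injective v ((hS (site v)).unique
      ⟨hi, (site_mem_sites_iff v _).2 ⟨i, rfl⟩⟩ ⟨hj, (site_mem_sites_iff v _).2 ⟨j, rfl⟩⟩)
  choose o ho using hex
  -- With this `k` the colour of bond `j` is `sgn v.2.2 * sgn (C (site v)) * (j - o v)`; the bond
  -- off the shaded hexagon gets colour `0`.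
  refine ⟨fun v => -(sgn v.2.2 * sgn (C (site v)) * o v), fun v j => ?_⟩
  -- If bond `j` lies on a shaded hexagon, both ends share that hexagon; if not, it is the missed
  -- bond at both ends.
  have h2 : o (honeycombGraph.nbr v j) = 2 * j - o v := by
    by_cases e : o v = j
    · by_contra h
      have h1 : o (honeycombGraph.nbr v j) ≠ j := by
        rintro h1; apply h; rw [h1, e]; ring
      have h3 := oppositeHexagon_nbr (honeycombGraph.nbr v j) _ _ h1
      rw [CubicGraph.nbr_nbr] at h3
      have h4 := huniq v _ _ (h3 ▸ ho (honeycombGraph.nbr v j)) (ho v)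
      apply h1
      linear_combination -h4 + (-1 : ZMod 3) * e
    · exact huniq _ _ _ (ho _) (by rw [oppositeHexagon_nbr _ _ _ e]; exact ho v)
  have h3 : (honeycombGraph.nbr v j).2.2 = -v.2.2 := rfl
  have h4 : sgn (-v.2.2) = -sgn v.2.2 := by simp [sgn]
  have h5 : honeycombGraph.side (honeycombGraph.nbr v j) = -v.2.2 := rfl
  have h6 : honeycombGraph.side v = v.2.2 := rfl
  simp only [CubicGraph.color, h2, h3, h4, h5, h6]
  -- Either both colours vanish, or both ends lie on one shaded hexagon and carry equal scatterers.
  by_cases e : o v = j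
  · rw [e]; ring
  · have : C (site (honeycombGraph.nbr v j)) = C (site v) :=
      hC _ (ho v) _ ((site_mem_sites_iff _ _).2 ⟨_, (oppositeHexagon_nbr v _ _ e).symm⟩) _
        ((site_mem_sites_iff _ _).2 ⟨_, rfl⟩)
    rw [this]; ring

theorem Hexagon.sites_nonempty (H : Hexagon) : H.sites.Nonempty := by
  obtain ⟨a, b⟩ := H
  exact ⟨site (a, b, 1), (site_mem_sites_iff _ _).2 ⟨0, by simp [oppositeHexagon, offset]⟩⟩

/-! ### Probability: constancy on shaded hexagons -/

/-- Almost surely, a shaded random configuration is constant on the shaded hexagons. -/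
theorem IsShadedRandomConfiguration.ae_constant {Ω : Type*} [MeasurableSpace Ω] {μ : Measure Ω}
    [IsProbabilityMeasure μ] {p : ℝ} (hp : p ∈ Set.Icc (0 : ℝ) 1) {S : Set Hexagon}
    {C : Ω → Configuration} (hC : IsShadedRandomConfiguration μ S p C) :
    ∀ᵐ ω ∂μ, ∀ H ∈ S, ∀ h ∈ H.sites, ∀ h' ∈ H.sites, C ω h = C ω h' := by
  have hmeas : ∀ (H : Hexagon) (z : ℤˣ), MeasurableSet {ω | ∀ h ∈ H.sites, C ω h = z} := by
    intro H z
    simp only [Set.ofPred_forall]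
    refine MeasurableSet.iInter fun h => MeasurableSet.iInter fun _ => ?_
    have hz : MeasurableSet ({z} : Set ℤˣ) :=
      ⟨{(z : ℤ)}, measurableSet_singleton _, by ext; simp [Units.val_inj]⟩
    exact hC.measurable h hz
  rw [ae_ball_iff (Set.to_countable S)]
  intro H hH
  have hd : Disjoint {ω | ∀ h ∈ H.sites, C ω h = 1} {ω | ∀ h ∈ H.sites, C ω h = -1} := by
    rw [Set.disjoint_left]
    intro ω h1 h2
    obtain ⟨h, hh⟩ := H.sites_nonempty
    have := (h1 h hh).symm.trans (h2 h hh)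
    exact absurd this (by decide)
  have hone : μ ({ω | ∀ h ∈ H.sites, C ω h = 1} ∪ {ω | ∀ h ∈ H.sites, C ω h = -1}) = 1 := by
    rw [measure_union hd (hmeas H _), hC.right H hH, hC.left H hH,
      ← ENNReal.ofReal_add hp.1 (sub_nonneg.2 hp.2)]
    simp
  have hae := (mem_ae_iff_prob_eq_one ((hmeas H 1).union (hmeas H (-1)))).2 hone
  filter_upwards [hae] with ω hω h hh h' hh'
  rcases hω with hω | hω <;> rw [hω h hh, hω h' hh']

/-! ### Return times and the conclusion -/

/-- The elements of a set of natural numbers that contains zero, listed in increasing order. -/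
theorem exists_enumeration (p : ℕ → Prop) (h0 : p 0) :
    ∃ (N : ℕ∞) (τ : ℕ → ℕ), τ 0 = 0 ∧
      (∀ i j : ℕ, i < j → (j : ℕ∞) ≤ N → τ i < τ j) ∧
      (∀ t : ℕ, p t ↔ ∃ i : ℕ, (i : ℕ∞) ≤ N ∧ τ i = t) := by
  -- `N` is the last index, counted from `0`. Beyond it `Nat.nth` only takes its default value `0`,
  -- hence the bound on the indices.
  have key : ∃ N : ℕ∞, ∀ i : ℕ, (i : ℕ∞) ≤ N ↔ ∀ hf : (Set.ofPred p).Finite, i < hf.toFinset.card := by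
    by_cases hf : (Set.ofPred p).Finite
    · have hpos : 0 < hf.toFinset.card := Finset.card_pos.2 ⟨0, hf.mem_toFinset.2 h0⟩
      refine ⟨((hf.toFinset.card - 1 : ℕ) : ℕ∞), fun i => ?_⟩
      rw [Nat.cast_le]
      exact ⟨fun h _ => by omega, fun h => by have := h hf; omega⟩
    · exact ⟨⊤, fun i => ⟨fun _ h => absurd h hf, fun _ => le_top⟩⟩
  obtain ⟨N, hN⟩ := key
  refine ⟨N, Nat.nth p, Nat.nth_zero_of_zero h0,
    fun i j hij hj => Nat.nth_lt_nth' hij ((hN j).1 hj), fun t => ⟨fun h => ?_, ?_⟩⟩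
  · obtain ⟨n, hn, e⟩ := Nat.exists_lt_card_nth_eq h
    exact ⟨n, (hN n).2 hn, e⟩
  · rintro ⟨i, hi, rfl⟩
    exact Nat.nth_mem i ((hN i).1 hi)

/-- The segment avoids all earlier sites, in particular the origin. From the last visit to the
origin before `t₁` up to `t₂` the path is then self-avoiding, against the repetition at the ends of
the first loop. -/
theorem not_isReflectingStructure {r : ℕ → ℂ} (h0 : r 0 = 0)
    (hr : ∀ τ t, r τ = 0 → (∀ u, τ < u → u ≤ t → r u ≠ 0) → Set.InjOn r (Set.Icc τ t))
    (t₁ t₂ : ℕ) : ¬ IsReflectingStructure r t₁ t₂ := by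
  rintro ⟨s, -, h2, h3, ⟨h4, -⟩, -, -, -, -, -, hd⟩
  have hne : ∀ u, t₁ ≤ u → u ≤ t₂ → r u ≠ 0 := fun u hu hu' e =>
    (Set.eq_empty_iff_forall_notMem.1 hd 0) ⟨⟨0, ⟨le_rfl, Nat.zero_le _⟩, h0⟩, ⟨u, ⟨hu, hu'⟩, e⟩⟩
  have hlast := Nat.findGreatest_spec (P := fun u => r u = 0) (Nat.zero_le t₁) h0
  have hle := Nat.findGreatest_le (P := fun u => r u = 0) t₁
  have hgt : ∀ u, Nat.findGreatest (fun u => r u = 0) t₁ < u → u ≤ t₂ → r u ≠ 0 := by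
    intro u hu hu'
    rcases le_total u t₁ with h | h
    · exact Nat.findGreatest_is_greatest hu h
    · exact hne u h hu'
  have := hr _ t₂ hlast hgt ⟨hle, by omega⟩ ⟨by omega, h3.le⟩ h4
  omega

end FlippingRotator

theorem mainTheorem7 {Ω : Type*} [MeasurableSpace Ω] (μ : Measure Ω) [IsProbabilityMeasure μ]
    (p : ℝ) (hp : p ∈ Set.Icc (0 : ℝ) 1)
    (S : Set Hexagon) (hS : IsShading S)
    (C : Ω → Configuration) (hC : IsShadedRandomConfiguration μ S p C) :
    ∀ᵐ ω ∂μ, ∃ (N : ℕ∞) (τ : ℕ → ℕ),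
      τ 0 = 0 ∧
      (∀ i j : ℕ, i < j → (j : ℕ∞) ≤ N → τ i < τ j) ∧
      (∀ t : ℕ, position (C ω) t = 0 ↔ ∃ i : ℕ, (i : ℕ∞) ≤ N ∧ τ i = t) ∧
      (∀ i : ℕ, 1 ≤ i → (i : ℕ∞) ≤ N →
        IsSelfAvoidingCycle (position (C ω)) (τ (i - 1)) (τ i)) ∧
      (∀ T : ℕ, IsGreatest {t : ℕ | position (C ω) t = 0} T →
        Set.InjOn (position (C ω)) (Set.Ici T)) ∧
      (∀ t₁ t₂ : ℕ, ¬ IsReflectingStructure (position (C ω)) t₁ t₂) := by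
  filter_upwards [hC.ae_constant hp] with ω hω
  have hcoh : honeycombGraph.Coherent (initialWalker (C ω)).cfg := hS.coherent hω
  have hzero : ∀ t, position (C ω) t = 0 ↔
      honeycombGraph.path (initialWalker (C ω)) t = (initialWalker (C ω)).pos := by
    intro t
    rw [position_eq, ← point_origin, point_injective.eq_iff]; rfl
  have h0 : position (C ω) 0 = 0 := rfl
  have hr : ∀ τ t, position (C ω) τ = 0 → (∀ u, τ < u → u ≤ t → position (C ω) u ≠ 0) →
      Set.InjOn (position (C ω)) (Set.Icc τ t) := by
    intro τ t hτ ht a ha b hb e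
    rw [position_eq, position_eq] at e
    exact hcoh.injOn_Icc ((hzero τ).1 hτ) (fun u h1 h2 h => ht u h1 h2 ((hzero u).2 h)) ha hb
      (point_injective e)
  obtain ⟨N, τ, hτ0, hlt, hmem⟩ := exists_enumeration (fun t => position (C ω) t = 0) h0
  refine ⟨N, τ, hτ0, hlt, hmem, fun i hi hiN => ?_, fun T hT => ?_,
    not_isReflectingStructure h0 hr⟩
  · have hi' : ((i - 1 : ℕ) : ℕ∞) ≤ N := le_trans (by exact_mod_cast Nat.sub_le i 1) hiN
    have hstep : τ (i - 1) < τ i := hlt _ _ (by omega) hiN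
    have hz := (hmem (τ (i - 1))).2 ⟨i - 1, hi', rfl⟩
    -- The half-open range of the cycle stops at `τ i - 1`, before the next visit to the origin.
    refine ⟨hstep, (hr _ (τ i - 1) hz ?_).mono ?_, hz.trans ((hmem (τ i)).2 ⟨i, hiN, rfl⟩).symm⟩
    · intro u h1 h2 h
      obtain ⟨j, hj, rfl⟩ := (hmem u).1 h
      rcases lt_trichotomy j i with h3 | rfl | h3
      · rcases Nat.lt_or_ge j (i - 1) with h4 | h4
        · have := hlt j (i - 1) h4 hi'
          omega
        · obtain rfl : j = i - 1 := by omega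
          omega
      · omega
      · have := hlt i j h3 hj
        omega
    · intro u hu
      exact ⟨hu.1, Nat.le_sub_one_of_lt hu.2⟩
  · intro a ha b hb e
    -- Any two times of the infinite tail lie in a finite window free of further returns.
    exact hr T (max a b) hT.1 (fun u h1 _ h => absurd (hT.2 h) (not_le.2 h1))
      ⟨ha, le_max_left _ _⟩ ⟨hb, le_max_right _ _⟩ e
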